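/- Let $\overline{\mathbb Q}\subset\mathbb C$ be the field of algebraic numbers and let $\Gamma\subset\overline{\mathbb Q}^*$ be a finitely generated subgroup. Let $\Gamma_{\mathrm{div}}$ be the set of $\gamma\in\overline{\mathbb Q}^*$ such that $\gamma^n\in\Gamma$ for some integer $n\ge 1$, and put $K_\Gamma=\mathbb Q(\mu_\infty,\Gamma)$, where $\mu_\infty$ is the group of all roots of unity. For $\alpha\in\overline{\mathbb Q}$ let $O_\Gamma(\alpha)$ be the (finite) orbit of $\alpha$ under $\mathrm{Gal}(\overline{\mathbb Q}/K_\Gamma)$, and for $\varepsilon>0$ put $$d_{\Gamma,\varepsilon}(\alpha)=\frac{\#\{x\in O_\Gamma(\alpha) : 1-\varepsilon\le |x|^2\le 1+\varepsilon\}}{\# O_\Gamma(\alpha)}.$$ The length of $x\in\mathbb Q(\Gamma_{\mathrm{div}})$ is the smallest integer $l\ge 1$ such that $x=\sum_{j=1}^l x_j\gamma_j$ with $x_j\in K_\Gamma$ and $\gamma_j\in\Gamma_{\mathrm{div}}$; for an integer $N\ge 1$, let $l_N(\Gamma)$ be the set of elements of $\mathbb Q(\Gamma_{\mathrm{div}})$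 of length at most $N$. **Theorem.** Let $N\ge 1$ be an integer and let $(y_n)$ be a sequence of elements of $l_N(\Gamma)$ such that $d_{\Gamma,\varepsilon}(y_n)\to 1$ as $n\to+\infty$ for every $\varepsilon>0$. Then for every $\varepsilon>0$ we have $d_{\Gamma,\varepsilon}(y_n)=1$ for all sufficiently large $n$; that is, every $x\in O_\Gamma(y_n)$ satisfies $1-\varepsilon\le|x|^2\le 1+\varepsilon$ for all sufficiently large $n$. -/

import Mathlib

open Filter Topology

namespace DivisionGroup

/-- The field of algebraic numbers, as a subfield of `ℂ`. -/
def Qbar : Type := algebraicClosure ℚ ℂ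

noncomputable instance : Field Qbar := inferInstanceAs (Field (algebraicClosure ℚ ℂ))

/-- The inclusion of `Qbar` in `ℂ`. -/
noncomputable def Qbar.toComplex : Qbar →+* ℂ := (algebraicClosure ℚ ℂ).val.toRingHom

instance : CharZero Qbar := Qbar.toComplex.charZero

instance : Algebra.IsAlgebraic ℚ Qbar where
  isAlgebraic x := by
    have h : IsAlgebraic ℚ (Qbar.toComplex x) := mem_algebraicClosure_iff.1 x.2
    exact (isAlgebraic_algHom_iff Qbar.toComplex.toRatAlgHom Qbar.toComplex.injective).1 h

instance : IsAlgClosed Qbar :=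
  (algebraicClosure.isAlgClosure ℚ ℂ).isAlgClosed

theorem Qbar.range_toComplex : Set.range Qbar.toComplex = {z : ℂ | IsAlgebraic ℚ z} := by
  ext z
  exact ⟨fun ⟨x, hx⟩ => hx ▸ mem_algebraicClosure_iff.1 x.2,
    fun hz => ⟨⟨z, mem_algebraicClosure_iff.2 hz⟩, rfl⟩⟩

/-- `Γ_div`: the `γ` in `Qbarˣ` some positive power of which lies in `Γ`. -/
def divGroup (Γ : Subgroup Qbarˣ) : Set Qbarˣ :=
  {γ | ∃ n : ℕ, 1 ≤ n ∧ γ ^ n ∈ Γ}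

/-- `ℚ(Γ_div)`. -/
noncomputable def divField (Γ : Subgroup Qbarˣ) : IntermediateField ℚ Qbar :=
  IntermediateField.adjoin ℚ (Units.val '' divGroup Γ)

/-- `K_Γ = ℚ(μ_∞, Γ)`. -/
noncomputable def baseField (Γ : Subgroup Qbarˣ) : IntermediateField ℚ Qbar :=
  IntermediateField.adjoin ℚ
    ({ζ : Qbar | ∃ n : ℕ, 1 ≤ n ∧ ζ ^ n = 1} ∪ Units.val '' (Γ : Set Qbarˣ))

/-- `O_Γ(α)`: the orbit of `α` under `Gal(Qbar / K_Γ)`. -/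
def galOrbit (Γ : Subgroup Qbarˣ) (α : Qbar) : Set Qbar :=
  MulAction.orbit (Qbar ≃ₐ[baseField Γ] Qbar) α

/-- `d_{Γ,ε}(α)`: the proportion of the `x ∈ O_Γ(α)` with `1 - ε ≤ |x|² ≤ 1 + ε`. -/
noncomputable def density (Γ : Subgroup Qbarˣ) (ε : ℝ) (α : Qbar) : ℝ :=
  ({x ∈ galOrbit Γ α | 1 - ε ≤ ‖x.toComplex‖ ^ 2 ∧ ‖x.toComplex‖ ^ 2 ≤ 1 + ε}.ncard : ℝ) /
    ((galOrbit Γ α).ncard : ℝ)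

/-- `x` is a sum of `l` terms `a γ` with `a ∈ K_Γ` and `γ ∈ Γ_div`. -/
def IsSumOfTerms (Γ : Subgroup Qbarˣ) (l : ℕ) (x : Qbar) : Prop :=
  ∃ (a : Fin l → Qbar) (γ : Fin l → Qbarˣ),
    (∀ j, a j ∈ baseField Γ) ∧ (∀ j, γ j ∈ divGroup Γ) ∧ x = ∑ j, a j * (γ j : Qbar)

/-- The length of `x`: the least `l ≥ 1` such that `x` is a sum of `l` terms `a γ` with
`a ∈ K_Γ` and `γ ∈ Γ_div`. It is used for `x ∈ ℚ(Γ_div)` only, where such an `l` exists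
(`exists_isSumOfTerms`). -/
noncomputable def length (Γ : Subgroup Qbarˣ) (x : Qbar) : ℕ :=
  sInf {l : ℕ | 1 ≤ l ∧ IsSumOfTerms Γ l x}

/-- `l_N(Γ)`: the elements of `ℚ(Γ_div)` of length at most `N`. -/
def lengthLE (Γ : Subgroup Qbarˣ) (N : ℕ) : Set Qbar :=
  {x | x ∈ divField Γ ∧ length Γ x ≤ N}

theorem galOrbit_finite (Γ : Subgroup Qbarˣ) (α : Qbar) : (galOrbit Γ α).Finite := by
  have hα : IsIntegral (baseField Γ) α :=
    (Algebra.IsIntegral.isIntegral (R := ℚ) α).tower_top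
  refine ((minpoly (baseField Γ) α).rootSet_finite Qbar).subset ?_
  rintro _ ⟨σ, rfl⟩
  rw [Polynomial.mem_rootSet]
  refine ⟨minpoly.ne_zero hα, ?_⟩
  change Polynomial.aeval (σ α) _ = 0
  rw [Polynomial.aeval_algHom_apply, minpoly.aeval, map_zero]

theorem exists_isSumOfTerms (Γ : Subgroup Qbarˣ) {x : Qbar} (hx : x ∈ divField Γ) :
    ∃ l : ℕ, 1 ≤ l ∧ IsSumOfTerms Γ l x := by
  have h1 : (1 : Qbarˣ) ∈ divGroup Γ := ⟨1, le_rfl, by simp⟩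
  have hmul : ∀ g ∈ divGroup Γ, ∀ h ∈ divGroup Γ, g * h ∈ divGroup Γ := by
    rintro g ⟨n, hn, hg⟩ h ⟨m, hm, hh⟩
    refine ⟨n * m, Nat.mul_pos hn hm, ?_⟩
    rw [mul_pow, pow_mul g, mul_comm n m, pow_mul h]
    exact Γ.mul_mem (Γ.pow_mem hg m) (Γ.pow_mem hh n)
  let M : Submonoid Qbar :=
    { carrier := Units.val '' divGroup Γ
      one_mem' := ⟨1, h1, rfl⟩
      mul_mem' := by
        rintro _ _ ⟨g, hg, rfl⟩ ⟨h, hh, rfl⟩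
        exact ⟨g * h, hmul g hg h hh, rfl⟩ }
  have hx' : x ∈ Algebra.adjoin ℚ (M : Set Qbar) := by
    have h := IntermediateField.adjoin_toSubalgebra_of_isAlgebraic (F := ℚ) (E := Qbar)
      (S := (M : Set Qbar)) (fun _ _ => Algebra.IsAlgebraic.isAlgebraic _)
    rw [← h]
    exact hx
  rw [← Subalgebra.mem_toSubmodule, Algebra.adjoin_eq_span, Submonoid.closure_eq] at hx'
  clear hx
  induction hx' using Submodule.span_induction with
  | mem y hy =>
    obtain ⟨g, hg, rfl⟩ := hy
    exact ⟨1, le_rfl, fun _ => 1, fun _ => g, fun _ => one_mem _, fun _ => hg, by simp⟩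
  | zero =>
    exact ⟨1, le_rfl, fun _ => 0, fun _ => 1, fun _ => zero_mem _, fun _ => h1, by simp⟩
  | add y z _ _ hy hz =>
    obtain ⟨l, hl, a, g, ha, hg, rfl⟩ := hy
    obtain ⟨m, hm, b, h, hb, hh, rfl⟩ := hz
    refine ⟨l + m, by omega, Fin.append a b, Fin.append g h, ?_, ?_, ?_⟩
    · intro j
      refine Fin.addCases (fun i => ?_) (fun i => ?_) j
      · simpa using ha i
      · simpa using hb i
    · intro j
      refine Fin.addCases (fun i => ?_) (fun i => ?_) j
      · simpa using hg i
      · simpa using hh i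
    · simp [Fin.sum_univ_add]
  | smul q y _ hy =>
    obtain ⟨l, hl, a, g, ha, hg, rfl⟩ := hy
    refine ⟨l, hl, fun j => q • a j, g, fun j => (baseField Γ).smul_mem (ha j), hg, ?_⟩
    simp [Finset.smul_sum]

end DivisionGroup

/-!
Let `y = ∑ j, a j * γ j` with `l ≤ N` terms. An automorphism over `K_Γ` fixes the `a j` and
multiplies each `γ j` by a root of unity, and since `K_Γ` contains all roots of unity these
multipliers are characters of the Galois group (`kummerHom`) that factor jointly through a finite
group `A`. All fibres of `A → O_Γ(y)` have the same size
(`card_filter_eq_ncard_orbit_mul`), so `density` is a proportion in `A`, and on `A` the function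
`|y|² - 1` becomes a linear combination of at most `N² + 1` characters.

Such combinations `g` of at most `M` characters satisfy a uniform comparison
(`norm_sq_le_of_le_on_most`): if `|g| ≤ ε` outside a proportion `1 / (2 M)` of the group, then
`|g| ≤ √(2 M) ε` everywhere. After collecting equal characters, let `S` be the sum of the absolute
values of the coefficients. Then `|g| ≤ S`, while Parseval and Cauchy-Schwarz bound the mean of
`|g|²` from below by `S² / M`; hence `S² / M ≤ ε² + S² / (2 M)`. As the constant depends on `N`
only, convergence of `|y n|²` to `1` in proportion forces uniform convergence.
-/

namespace DivisionGroup

open Finset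

/-! ### Sums of few characters of a finite group -/

section Characters

variable {A : Type*} [Group A] [Fintype A]

theorem norm_character_apply (ψ : A →* ℂ) (a : A) : ‖ψ a‖ = 1 :=
  Complex.norm_eq_one_of_pow_eq_one (n := Fintype.card A) (by rw [← map_pow, pow_card_eq_one, map_one])
    Fintype.card_ne_zero

theorem character_mul_star (ψ : A →* ℂ) (a : A) : ψ a * star (ψ a) = 1 := by
  rw [Complex.star_def, Complex.mul_conj, Complex.normSq_eq_norm_sq, norm_character_apply]
  simp

/-- The conjugate character. -/
noncomputable def conjCharacter {A : Type*} [Group A] (ψ : A →* ℂ) : A →* ℂ :=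
  (starRingEnd ℂ : ℂ →* ℂ).comp ψ

theorem conjCharacter_apply {A : Type*} [Group A] (ψ : A →* ℂ) (a : A) : conjCharacter ψ a = star (ψ a) := rfl

theorem sum_character_mul_star [DecidableEq (A →* ℂ)] (χ ψ : A →* ℂ) :
    ∑ a, χ a * star (ψ a) = if χ = ψ then (Fintype.card A : ℂ) else 0 := by
  split_ifs with h
  · subst h
    simp only [character_mul_star, sum_const, card_univ, nsmul_eq_mul, mul_one]
  · have hne : χ * conjCharacter ψ ≠ 1 := by
      intro h1
      apply h
      ext a
      have h2 : χ a * star (ψ a) = 1 := DFunLike.congr_fun h1 a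
      calc χ a = χ a * (ψ a * star (ψ a)) := by rw [character_mul_star, mul_one]
        _ = ψ a * (χ a * star (ψ a)) := by ring
        _ = ψ a := by rw [h2, mul_one]
    exact sum_hom_units_eq_zero _ hne

/-- Parseval's identity for a combination of distinct characters. -/
theorem sum_norm_sq_character_sum (s : Finset (A →* ℂ)) (d : (A →* ℂ) → ℂ) :
    ∑ a, ‖∑ χ ∈ s, d χ * χ a‖ ^ 2 = Fintype.card A * ∑ χ ∈ s, ‖d χ‖ ^ 2 := by
  classical
  have key : ∑ a, (∑ χ ∈ s, d χ * χ a) * star (∑ χ ∈ s, d χ * χ a) =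
      Fintype.card A * ∑ χ ∈ s, d χ * star (d χ) := by
    calc ∑ a, (∑ χ ∈ s, d χ * χ a) * star (∑ χ ∈ s, d χ * χ a)
        = ∑ a, ∑ χ ∈ s, ∑ ψ ∈ s, d χ * star (d ψ) * (χ a * star (ψ a)) := by
          refine sum_congr rfl fun a _ => ?_
          rw [star_sum, sum_mul_sum]
          refine sum_congr rfl fun χ _ => sum_congr rfl fun ψ _ => ?_
          rw [star_mul']
          ring
      _ = ∑ χ ∈ s, ∑ ψ ∈ s, d χ * star (d ψ) * ∑ a, χ a * star (ψ a) := by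
          rw [sum_comm]
          refine sum_congr rfl fun χ _ => ?_
          rw [sum_comm]
          simp only [mul_sum]
      _ = _ := by
          rw [mul_sum]
          refine sum_congr rfl fun χ hχ => ?_
          simp only [sum_character_mul_star, mul_ite, mul_zero, sum_ite_eq, if_pos hχ]
          ring
  simp only [Complex.star_def, Complex.mul_conj, Complex.normSq_eq_norm_sq] at key
  exact_mod_cast key

/-- A combination of at most `M` characters that is bounded by `ε` outside a small proportion of
the group is bounded by `√(2 M) ε` everywhere. The characters need not be distinct. -/
theorem norm_sq_le_of_le_on_most {ι : Type*} [Fintype ι] (ψ : ι → A →* ℂ) (c : ι → ℂ)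
    {M : ℕ} (hM : Fintype.card ι ≤ M) {ε : ℝ} (E : Finset A)
    (hE : ∀ a ∈ E, ‖∑ i, c i * ψ i a‖ ≤ ε)
    (hcard : 2 * M * (Fintype.card A - #E : ℝ) ≤ Fintype.card A) (a : A) :
    ‖∑ i, c i * ψ i a‖ ^ 2 ≤ 2 * M * ε ^ 2 := by
  classical
  set s : Finset (A →* ℂ) := univ.image ψ
  set d : (A →* ℂ) → ℂ := fun χ => ∑ i with ψ i = χ, c i
  have hg : ∀ b, ∑ i, c i * ψ i b = ∑ χ ∈ s, d χ * χ b := by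
    intro b
    rw [← sum_fiberwise_of_maps_to (s := univ) (t := s) (g := ψ)
      (fun i _ => mem_image_of_mem _ (mem_univ i))]
    refine sum_congr rfl fun χ _ => ?_
    rw [sum_mul]
    refine sum_congr rfl fun i hi => ?_
    rw [(mem_filter.1 hi).2]
  have hs : (#s : ℝ) ≤ M := by
    exact_mod_cast (card_image_le.trans_eq card_univ).trans hM
  simp only [hg] at hE ⊢
  set S : ℝ := ∑ χ ∈ s, ‖d χ‖
  have hS0 : 0 ≤ S := sum_nonneg fun _ _ => norm_nonneg _
  have hsup : ∀ b, ‖∑ χ ∈ s, d χ * χ b‖ ^ 2 ≤ S ^ 2 := by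
    intro b
    refine pow_le_pow_left₀ (norm_nonneg _) ((norm_sum_le _ _).trans_eq ?_) 2
    simp [norm_character_apply, S]
  have hQ0 : 0 ≤ ∑ χ ∈ s, ‖d χ‖ ^ 2 := sum_nonneg fun _ _ => sq_nonneg _
  have hcs : S ^ 2 ≤ M * ∑ χ ∈ s, ‖d χ‖ ^ 2 :=
    sq_sum_le_card_mul_sum_sq.trans (mul_le_mul_of_nonneg_right hs hQ0)
  have hcompl : (#Eᶜ : ℝ) = Fintype.card A - #E := by
    rw [card_compl, Nat.cast_sub (card_le_univ E)]
  have hsplit : Fintype.card A * ∑ χ ∈ s, ‖d χ‖ ^ 2 ≤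
      #E * ε ^ 2 + (Fintype.card A - #E) * S ^ 2 := by
    rw [← sum_norm_sq_character_sum, ← sum_add_sum_compl E, ← hcompl]
    refine add_le_add ?_ ?_
    · rw [← nsmul_eq_mul]
      exact sum_le_card_nsmul _ _ _ fun b hb => pow_le_pow_left₀ (norm_nonneg _) (hE b hb) 2
    · rw [← nsmul_eq_mul]
      exact sum_le_card_nsmul _ _ _ fun b _ => hsup b
  have hn : (0 : ℝ) < Fintype.card A := by exact_mod_cast Fintype.card_pos
  have hEn : (#E : ℝ) ≤ Fintype.card A := by exact_mod_cast card_le_univ E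
  have hM0 : (0 : ℝ) ≤ M := M.cast_nonneg
  -- `card A * S² ≤ M * card A * ε² + (card A / 2) * S²`
  have h1 := mul_le_mul_of_nonneg_left hcs hn.le
  have h2 := mul_le_mul_of_nonneg_left hsplit hM0
  have h3 := mul_le_mul_of_nonneg_right hcard (sq_nonneg S)
  have h4 := mul_le_mul_of_nonneg_right hEn (mul_nonneg hM0 (sq_nonneg ε))
  have h5 : Fintype.card A * S ^ 2 ≤ Fintype.card A * (2 * M * ε ^ 2) := by nlinarith
  exact (hsup a).trans (le_of_mul_le_mul_left h5 hn)

/-- If the squared modulus of a sum of at most `N` characters lies within `δ` of `1` on most of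
the group, then it is uniformly close to `1`. -/
theorem abs_norm_sq_sub_one_sq_le {l N : ℕ} (hl : l ≤ N) (ψ : Fin l → A →* ℂ) (c : Fin l → ℂ)
    {δ : ℝ} (E : Finset A) (hE : ∀ a ∈ E, |‖∑ i, c i * ψ i a‖ ^ 2 - 1| ≤ δ)
    (hcard : 2 * (N ^ 2 + 1 : ℕ) * (Fintype.card A - #E : ℝ) ≤ Fintype.card A) (a : A) :
    |‖∑ i, c i * ψ i a‖ ^ 2 - 1| ^ 2 ≤ 2 * (N ^ 2 + 1 : ℕ) * δ ^ 2 := by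
  -- the pairs `(i, j)` index the terms of `|f|²`, and `none` the constant `-1`
  let Ψ : Option (Fin l × Fin l) → A →* ℂ :=
    fun o => o.elim 1 fun p => ψ p.1 * conjCharacter (ψ p.2)
  let C : Option (Fin l × Fin l) → ℂ := fun o => o.elim (-1) fun p => c p.1 * star (c p.2)
  have hΨ : ∀ b, ‖∑ o, C o * Ψ o b‖ = |‖∑ i, c i * ψ i b‖ ^ 2 - 1| := by
    intro b
    rw [← Real.norm_eq_abs, ← Complex.norm_real]
    congr 1
    have h : ((‖∑ i, c i * ψ i b‖ ^ 2 : ℝ) : ℂ) =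
        (∑ i, c i * ψ i b) * star (∑ i, c i * ψ i b) := by
      rw [Complex.star_def, Complex.mul_conj, Complex.normSq_eq_norm_sq]
    rw [Complex.ofReal_sub, h, star_sum, sum_mul_sum, Fintype.sum_option, Fintype.sum_prod_type,
      Complex.ofReal_one]
    simp only [C, Ψ, Option.elim, MonoidHom.mul_apply, MonoidHom.one_apply, conjCharacter_apply,
      star_mul']
    rw [mul_one, neg_add_eq_sub]
    congr 1
    exact sum_congr rfl fun i _ => sum_congr rfl fun j _ => by ring
  have hM : Fintype.card (Option (Fin l × Fin l)) ≤ N ^ 2 + 1 := by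
    simp only [Fintype.card_option, Fintype.card_prod, Fintype.card_fin]
    nlinarith
  have := norm_sq_le_of_le_on_most Ψ C hM E (fun b hb => (hΨ b).trans_le (hE b hb)) hcard a
  rwa [hΨ] at this

end Characters

/-! ### Proportions in an orbit -/

/-- If the action of `G` on the orbit of `x` factors through a finite quotient `A` of `G`, then
all fibres of the orbit map `A → G • x` have the size of the fibre above `x`. -/
theorem card_filter_eq_ncard_orbit_mul {G X A : Type*} [Group G] [MulAction G X] [Group A]
    [Fintype A] (Φ : G →* A) (hΦ : Function.Surjective Φ) (x : X) (f : A → X)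
    (hf : ∀ σ, f (Φ σ) = σ • x) (p : X → Prop) [DecidablePred fun a => p (f a)]
    [DecidableEq X] :
    #{a | p (f a)} = {z ∈ MulAction.orbit G x | p z}.ncard * #{a | f a = x} := by
  classical
  have himage : {z ∈ MulAction.orbit G x | p z} = ↑(({a | p (f a)} : Finset A).image f) := by
    ext z
    simp only [Set.mem_ofPred_eq, coe_image, Set.mem_image, coe_filter, mem_univ, true_and]
    constructor
    · rintro ⟨⟨σ, rfl⟩, hp⟩
      exact ⟨Φ σ, by rw [hf]; exact hp, hf σ⟩
    · rintro ⟨a, hp, rfl⟩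
      obtain ⟨σ, rfl⟩ := hΦ a
      exact ⟨⟨σ, (hf σ).symm⟩, hp⟩
  have hfibre : ∀ b : A, #{a | f a = f b} = #{a | f a = x} := by
    intro b
    obtain ⟨σ, rfl⟩ := hΦ b
    refine card_equiv (Equiv.mulLeft (Φ σ)⁻¹) fun a => ?_
    obtain ⟨τ, rfl⟩ := hΦ a
    simp only [mem_filter, mem_univ, true_and, Equiv.coe_mulLeft, ← map_inv, ← map_mul, hf,
      mul_smul, inv_smul_eq_iff]
  rw [himage, Set.ncard_coe_finset, card_eq_sum_card_image f, ← smul_eq_mul, ← sum_const]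
  refine sum_congr rfl fun z hz => ?_
  obtain ⟨b, hb, rfl⟩ := mem_image.1 hz
  rw [← hfibre b, filter_filter]
  congr 1
  refine filter_congr fun a _ => ⟨fun h => h.2, fun h => ⟨?_, h⟩⟩
  rw [h]
  exact (mem_filter.1 hb).2

/-! ### The Kummer characters -/

theorem mem_baseField_of_pow_eq_one (Γ : Subgroup Qbarˣ) {m : ℕ} (hm : 1 ≤ m) {ζ : Qbar}
    (hζ : ζ ^ m = 1) : ζ ∈ baseField Γ :=
  IntermediateField.subset_adjoin _ _ (Or.inl ⟨m, hm, hζ⟩)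

theorem units_mem_baseField (Γ : Subgroup Qbarˣ) {γ : Qbarˣ} (hγ : γ ∈ Γ) :
    (γ : Qbar) ∈ baseField Γ :=
  IntermediateField.subset_adjoin _ _ (Or.inr ⟨γ, hγ, rfl⟩)

theorem galois_apply_of_mem {Γ : Subgroup Qbarˣ} (σ : Qbar ≃ₐ[baseField Γ] Qbar) {x : Qbar}
    (hx : x ∈ baseField Γ) : σ x = x :=
  σ.commutes ⟨x, hx⟩

/-- The Kummer character `σ ↦ σ γ / γ` of an `m`-th root `γ` of an element of `Γ`. It is a
homomorphism because its values are roots of unity, which lie in `K_Γ`. -/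
noncomputable def kummerHom (Γ : Subgroup Qbarˣ) {m : ℕ} (hm : 1 ≤ m) (γ : Qbarˣ)
    (hγ : γ ^ m ∈ Γ) : (Qbar ≃ₐ[baseField Γ] Qbar) →* rootsOfUnity m Qbar :=
  have hroot : ∀ σ : Qbar ≃ₐ[baseField Γ] Qbar, (σ γ / γ) ^ m = 1 := by
    intro σ
    have h : σ ((γ : Qbar) ^ m) = (γ : Qbar) ^ m := by
      have := galois_apply_of_mem σ (units_mem_baseField Γ hγ)
      rwa [Units.val_pow_eq_pow_val] at this
    rw [div_pow, ← map_pow, h, div_self (pow_ne_zero _ γ.ne_zero)]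
  { toFun := fun σ => ⟨Units.mk0 (σ γ / γ) fun h => by
        have := hroot σ
        rw [h, zero_pow (by omega)] at this
        exact zero_ne_one this, by
        rw [mem_rootsOfUnity]
        ext
        simpa using hroot σ⟩
    map_one' := by
      ext
      simp
    map_mul' := fun σ τ => by
      ext
      have h : σ (τ γ / γ) = τ γ / γ :=
        galois_apply_of_mem σ (mem_baseField_of_pow_eq_one Γ hm (hroot τ))
      have hγ0 := γ.ne_zero
      have hσ0 : σ γ ≠ 0 := (map_ne_zero σ).2 hγ0
      rw [map_div₀, div_eq_iff hσ0] at h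
      change σ (τ γ) / γ = σ γ / γ * (τ γ / γ)
      rw [h]
      field_simp }

theorem kummerHom_apply_mul (Γ : Subgroup Qbarˣ) {m : ℕ} (hm : 1 ≤ m) (γ : Qbarˣ)
    (hγ : γ ^ m ∈ Γ) (σ : Qbar ≃ₐ[baseField Γ] Qbar) :
    ((kummerHom Γ hm γ hγ σ : Qbarˣ) : Qbar) * γ = σ γ :=
  div_mul_cancel₀ _ γ.ne_zero

theorem exists_isSumOfTerms_of_mem_lengthLE {Γ : Subgroup Qbarˣ} {N : ℕ} {x : Qbar}
    (hx : x ∈ lengthLE Γ N) : ∃ l ≤ N, IsSumOfTerms Γ l x :=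
  ⟨length Γ x, hx.2, (Nat.sInf_mem (exists_isSumOfTerms Γ hx.1)).2⟩

theorem exists_common_exponent {Γ : Subgroup Qbarˣ} {l : ℕ} {γ : Fin l → Qbarˣ}
    (hγ : ∀ j, γ j ∈ divGroup Γ) : ∃ m : ℕ, 1 ≤ m ∧ ∀ j, γ j ^ m ∈ Γ := by
  choose n hn hmem using hγ
  refine ⟨∏ j, n j, Nat.succ_le_of_lt (Finset.prod_pos fun j _ => hn j), fun j => ?_⟩
  obtain ⟨k, hk⟩ := Finset.dvd_prod_of_mem n (Finset.mem_univ j)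
  rw [hk, pow_mul]
  exact Γ.pow_mem (hmem j) k

/-- The orbit map of an element of length at most `N`, seen on a finite quotient `A` of the Galois
group, is a sum of at most `N` characters of `A`. -/
theorem exists_finite_quotient {Γ : Subgroup Qbarˣ} {N : ℕ} {x : Qbar} (hx : x ∈ lengthLE Γ N) :
    ∃ (l : ℕ) (A : Type) (_ : Group A) (_ : Fintype A)
      (Φ : (Qbar ≃ₐ[baseField Γ] Qbar) →* A) (f : A → Qbar) (ψ : Fin l → A →* ℂ)
      (c : Fin l → ℂ), l ≤ N ∧ Function.Surjective Φ ∧ (∀ σ, f (Φ σ) = σ • x) ∧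
        ∀ a, (f a).toComplex = ∑ j, c j * ψ j a := by
  obtain ⟨l, hl, a, γ, ha, hγ, rfl⟩ := exists_isSumOfTerms_of_mem_lengthLE hx
  obtain ⟨m, hm, hmem⟩ := exists_common_exponent hγ
  have : NeZero m := ⟨by omega⟩
  let Φ : (Qbar ≃ₐ[baseField Γ] Qbar) →* (Fin l → rootsOfUnity m Qbar) :=
    MonoidHom.pi fun j => kummerHom Γ hm (γ j) (hmem j)
  let ev : Fin l → Φ.range →* Qbar := fun j =>
    (Units.coeHom Qbar).comp
      ((rootsOfUnity m Qbar).subtype.comp ((Pi.evalMonoidHom _ j).comp Φ.range.subtype))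
  refine ⟨l, Φ.range, inferInstance, Fintype.ofFinite _, Φ.rangeRestrict,
    fun b => ∑ j, a j * γ j * ev j b, fun j => (Qbar.toComplex : Qbar →* ℂ).comp (ev j),
    fun j => (a j * γ j).toComplex, hl, Φ.rangeRestrict_surjective, fun σ => ?_, fun b => ?_⟩
  · change _ = σ (∑ j, a j * (γ j : Qbar))
    rw [map_sum]
    refine Finset.sum_congr rfl fun j _ => ?_
    rw [map_mul, galois_apply_of_mem σ (ha j), ← kummerHom_apply_mul Γ hm (γ j) (hmem j) σ,
      mul_assoc, mul_comm (γ j : Qbar)]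
    rfl
  · rw [map_sum]
    exact Finset.sum_congr rfl fun j _ => map_mul _ _ _

/-! ### From most of the orbit to the whole orbit -/

/-- Closeness of `|x|²` to `1` on a large enough proportion of the orbit implies closeness on the
whole orbit, with constants depending on `N` only. -/
theorem density_eq_one_of_le {Γ : Subgroup Qbarˣ} {N : ℕ} {x : Qbar} (hx : x ∈ lengthLE Γ N)
    {ε δ : ℝ} (hε : 0 ≤ ε) (hδ : 2 * (N ^ 2 + 1 : ℕ) * δ ^ 2 ≤ ε ^ 2)
    (hd : 2 * (N ^ 2 + 1 : ℕ) * (1 - density Γ δ x) ≤ 1) : density Γ ε x = 1 := by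
  classical
  obtain ⟨l, A, _, _, Φ, f, ψ, c, hl, hΦ, hf, hfc⟩ := exists_finite_quotient hx
  have hiff : ∀ (η : ℝ) (z : Qbar), (1 - η ≤ ‖z.toComplex‖ ^ 2 ∧ ‖z.toComplex‖ ^ 2 ≤ 1 + η) ↔
      |‖z.toComplex‖ ^ 2 - 1| ≤ η := by
    intro η z
    rw [abs_le]
    constructor <;> rintro ⟨h1, h2⟩ <;> constructor <;> linarith
  have hpos : 0 < ((galOrbit Γ x).ncard : ℝ) := by
    exact_mod_cast (Set.ncard_pos (galOrbit_finite Γ x)).2 ⟨x, MulAction.mem_orbit_self x⟩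
  have hall : Fintype.card A = (galOrbit Γ x).ncard * #{a | f a = x} := by
    simpa [galOrbit] using card_filter_eq_ncard_orbit_mul Φ hΦ x f hf fun _ => True
  have hmost := card_filter_eq_ncard_orbit_mul Φ hΦ x f hf
    fun z => 1 - δ ≤ ‖z.toComplex‖ ^ 2 ∧ ‖z.toComplex‖ ^ 2 ≤ 1 + δ
  set E : Finset A :=
    {a | 1 - δ ≤ ‖(f a).toComplex‖ ^ 2 ∧ ‖(f a).toComplex‖ ^ 2 ≤ 1 + δ}
  have hcard : (#E : ℝ) = density Γ δ x * Fintype.card A := by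
    rw [hmost, hall, density]
    push_cast
    rw [← mul_assoc, div_mul_cancel₀ _ hpos.ne']
    rfl
  have key := abs_norm_sq_sub_one_sq_le hl ψ c (δ := δ) E
    (fun a ha => by
      rw [← hfc]
      exact (hiff δ (f a)).1 (mem_filter.1 ha).2)
    (by
      rw [hcard]
      have := mul_le_mul_of_nonneg_right hd ((Fintype.card A).cast_nonneg (α := ℝ))
      linarith)
  have hset : {z ∈ galOrbit Γ x | 1 - ε ≤ ‖z.toComplex‖ ^ 2 ∧ ‖z.toComplex‖ ^ 2 ≤ 1 + ε} =
      galOrbit Γ x := by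
    refine Set.sep_eq_self_iff_mem_true.2 ?_
    rintro _ ⟨σ, rfl⟩
    rw [hiff]
    have h := (key (Φ σ)).trans hδ
    rw [← hfc, hf] at h
    exact (abs_le_of_sq_le_sq h hε).trans' (le_abs_self _)
  rw [density, hset, div_self hpos.ne']

end DivisionGroup

theorem mainTheorem4 (Γ : Subgroup DivisionGroup.Qbarˣ) (hΓ : Γ.FG) (N : ℕ) (hN : 1 ≤ N)
    (y : ℕ → DivisionGroup.Qbar) (hy : ∀ n, y n ∈ DivisionGroup.lengthLE Γ N)
    (hd : ∀ ε : ℝ, 0 < ε →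
      Tendsto (fun n => DivisionGroup.density Γ ε (y n)) atTop (𝓝 1)) :
    ∀ ε : ℝ, 0 < ε → ∀ᶠ n in atTop, DivisionGroup.density Γ ε (y n) = 1 := by
  intro ε hε
  set M : ℝ := 2 * (N ^ 2 + 1 : ℕ)
  have hM : 0 < M := by positivity
  have hsqrt : 0 < √M := Real.sqrt_pos.2 hM
  have hev := (hd (ε / √M) (by positivity)).eventually_const_le
    (show 1 - M⁻¹ < 1 by linarith [inv_pos.2 hM])
  filter_upwards [hev] with n hn
  refine DivisionGroup.density_eq_one_of_le (hy n) hε.le (δ := ε / √M) ?_ ?_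
  · rw [div_pow, Real.sq_sqrt hM.le, mul_div_cancel₀ _ hM.ne']
  · calc M * (1 - DivisionGroup.density Γ (ε / √M) (y n)) ≤ M * M⁻¹ :=
          mul_le_mul_of_nonneg_left (by linarith) hM.le
      _ = 1 := mul_inv_cancel₀ hM.ne'
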